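/- Call a polygon $P$ the region bounded by a simple closed polygonal chain $\partial P$ in the plane, with finitely many vertices listed in counterclockwise order and no vertex collinear with its two neighbours; its interior $\mathrm{int}(P)$ is the open set enclosed by $\partial P$. $P$ is monotone if it can be rotated so that its intersection with every vertical line is a connected (possibly empty) interval. An edge is the closed segment between two consecutive vertices; a diagonal is the closed segment between two non-consecutive vertices $r,s$ that lies in $\mathrm{int}(P)$ except for its endpoints $r,s$. A closed mobile guard is an edge or a diagonal, including both of its endpoints. A guard $g$ sees a location $l$ if there is a point $p\in g$ such that the segment $lp$ without its endpoints lies in $\mathrm{int}(P)$; two guards $g_1,g_2$ see each other if there are $p\in g_1$, $q\in g_2$ with $pq\setminus\{p,q\}\subseteq \mathrm{int}(P)$ (in particular, two guards that share a point see each other). A hidden closed mobile guard set of $P$ is a set $S$ of closed mobile guards such that every location in $\mathrm{int}(P)$ is seen by at least one guard in $S$ and no two distinct guards in $S$ see each other. **Lemma.** There exists a monotone polygon that does not admit a hidden closed mobile guard set. -/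

import Mathlib

namespace HiddenGuards

/-- The Euclidean plane. -/
abbrev Plane := EuclideanSpace ℝ (Fin 2)

/-- A simple polygon, given by its cyclic sequence of `n ≥ 3` vertices in counterclockwise order.
The edges are the segments from `vertex i` to `vertex (i + 1)`, with indices modulo `n`. -/
structure SimplePolygon where
  /-- the number of vertices -/
  n : ℕ
  three_le : 3 ≤ n
  /-- the vertices in cyclic order -/
  vertex : ZMod n → Plane
  /-- every vertex is a genuine corner: it is not on a line with its two neighbours -/
  corner : ∀ i, ¬ Collinear ℝ {vertex i, vertex (i + 1), vertex (i + 2)}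
  /-- consecutive edges meet only in their common vertex -/
  consecutive_inter : ∀ i,
    segment ℝ (vertex i) (vertex (i + 1)) ∩ segment ℝ (vertex (i + 1)) (vertex (i + 1 + 1)) =
      {vertex (i + 1)}
  /-- distinct non-consecutive edges are disjoint -/
  nonconsecutive_disjoint : ∀ i j, j ≠ i → j ≠ i + 1 → i ≠ j + 1 →
    Disjoint (segment ℝ (vertex i) (vertex (i + 1))) (segment ℝ (vertex j) (vertex (j + 1)))
  /-- the orientation is counterclockwise: twice the signed area (shoelace sum) is positive -/
  counterclockwise : 0 < ∑ k ∈ Finset.range n,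
    (vertex (k : ZMod n) 0 * vertex ((k : ZMod n) + 1) 1 -
      vertex ((k : ZMod n) + 1) 0 * vertex (k : ZMod n) 1)

namespace SimplePolygon

variable (P : SimplePolygon)

/-- The (closed) edge from `vertex i` to `vertex (i + 1)`. -/
def edge (i : ZMod P.n) : Set Plane := segment ℝ (P.vertex i) (P.vertex (i + 1))

/-- The boundary of the polygon: the closed polygonal chain. -/
def boundary : Set Plane := ⋃ i, P.edge i

/-- The interior of the polygon, i.e. the set enclosed by the boundary: the points off the boundary
whose connected component in the complement of the boundary is bounded. -/
def int : Set Plane :=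
  {x | x ∈ P.boundaryᶜ ∧ Bornology.IsBounded (connectedComponentIn P.boundaryᶜ x)}

/-- The polygon as a region of the plane: its interior together with its boundary. -/
def region : Set Plane := P.int ∪ P.boundary

/-- A polygon is monotone if it can be rotated such that its intersection with every vertical line
is a connected (possibly empty) interval. -/
def IsMonotone : Prop :=
  ∃ ρ : Plane ≃ₗᵢ[ℝ] Plane,
    LinearMap.det (ρ.toLinearEquiv : Plane →ₗ[ℝ] Plane) = 1 ∧
      ∀ c : ℝ, IsPreconnected ((ρ '' P.region) ∩ {x | x 0 = c})

/-- Two points are mutually visible if the segment between them, without its endpoints, lies in the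
interior of the polygon. -/
def Visible (p q : Plane) : Prop := segment ℝ p q \ {p, q} ⊆ P.int

/-- The closed edges of the polygon. -/
def IsEdge (g : Set Plane) : Prop := ∃ i, g = P.edge i

/-- The closed diagonals of the polygon: segments between non-consecutive vertices that lie, apart
from their endpoints, in the interior of the polygon. -/
def IsDiagonal (g : Set Plane) : Prop :=
  ∃ i j, j ≠ i ∧ j ≠ i + 1 ∧ i ≠ j + 1 ∧
    g = segment ℝ (P.vertex i) (P.vertex j) ∧
    segment ℝ (P.vertex i) (P.vertex j) \ {P.vertex i, P.vertex j} ⊆ P.int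

/-- A closed mobile guard is an edge or a diagonal, including its two endpoints. -/
def IsClosedMobileGuard (g : Set Plane) : Prop := P.IsEdge g ∨ P.IsDiagonal g

/-- The guard `g` sees the location `l` (weak visibility). -/
def GuardSees (g : Set Plane) (l : Plane) : Prop := ∃ p ∈ g, P.Visible l p

/-- The guards `g` and `h` see each other. -/
def GuardsSeeEachOther (g h : Set Plane) : Prop := ∃ p ∈ g, ∃ q ∈ h, P.Visible p q

/-- `S` is a closed mobile guard set of `P`: it consists of closed edges and diagonals, and every
location in the interior is seen by at least one of them. -/
def IsClosedMobileGuardSet (S : Set (Set Plane)) : Prop :=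
  (∀ g ∈ S, P.IsClosedMobileGuard g) ∧ ∀ l ∈ P.int, ∃ g ∈ S, P.GuardSees g l

/-- `S` is hidden: no two distinct guards in `S` see each other. -/
def IsHidden (S : Set (Set Plane)) : Prop :=
  ∀ g ∈ S, ∀ h ∈ S, g ≠ h → ¬ P.GuardsSeeEachOther g h

/-- `P` admits a hidden closed mobile guard set. -/
def AdmitsHiddenClosedMobileGuardSet : Prop :=
  ∃ S : Set (Set Plane), P.IsClosedMobileGuardSet S ∧ P.IsHidden S

end SimplePolygon

end HiddenGuards

namespace HiddenGuards

/-- The point of the plane with the given coordinates. -/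
noncomputable def pt (x y : ℝ) : Plane := !₂[x, y]

@[simp] theorem pt_zero (x y : ℝ) : pt x y 0 = x := by simp [pt]

@[simp] theorem pt_one (x y : ℝ) : pt x y 1 = y := by simp [pt]

theorem plane_ext {p q : Plane} (h0 : p 0 = q 0) (h1 : p 1 = q 1) : p = q := by
  ext i; fin_cases i <;> assumption

theorem mem_segment_iff_coord {p q z : Plane} :
    z ∈ segment ℝ p q ↔ ∃ t : ℝ, 0 ≤ t ∧ t ≤ 1 ∧
      z 0 = p 0 + t * (q 0 - p 0) ∧ z 1 = p 1 + t * (q 1 - p 1) := by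
  rw [segment_eq_image']
  constructor
  · rintro ⟨t, ⟨h0, h1⟩, rfl⟩
    exact ⟨t, h0, h1, by simp, by simp⟩
  · rintro ⟨t, h0, h1, hx, hy⟩
    exact ⟨t, ⟨h0, h1⟩, plane_ext (by simp [hx]) (by simp [hy])⟩

/-- A non-vertical segment is the part of a line over an interval. -/
theorem mem_segment_iff_line {p q z : Plane} (h : p 0 < q 0) :
    z ∈ segment ℝ p q ↔ p 0 ≤ z 0 ∧ z 0 ≤ q 0 ∧
      (z 1 - p 1) * (q 0 - p 0) = (q 1 - p 1) * (z 0 - p 0) := by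
  rw [mem_segment_iff_coord]
  have hd : 0 < q 0 - p 0 := sub_pos.2 h
  constructor
  · rintro ⟨t, h0, h1, hx, hy⟩
    refine ⟨?_, ?_, ?_⟩
    · nlinarith
    · nlinarith
    · rw [hx, hy]; ring
  · rintro ⟨h0, h1, he⟩
    refine ⟨(z 0 - p 0) / (q 0 - p 0), div_nonneg (by linarith) hd.le,
      (div_le_one hd).2 (by linarith), ?_, ?_⟩
    · field_simp; ring
    · field_simp; linarith

theorem det_eq_zero_of_collinear {a b c : Plane} (h : Collinear ℝ {a, b, c}) :
    (b 0 - a 0) * (c 1 - a 1) - (b 1 - a 1) * (c 0 - a 0) = 0 := by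
  obtain ⟨v, hv⟩ := (collinear_iff_of_mem (p₀ := a) (by simp)).1 h
  obtain ⟨r, hr⟩ := hv b (by simp)
  obtain ⟨s, hs⟩ := hv c (by simp)
  subst hr hs
  simp
  ring

theorem segment_inter_segment_of_det_ne_zero {a b c : Plane}
    (h : (b 0 - a 0) * (c 1 - a 1) - (b 1 - a 1) * (c 0 - a 0) ≠ 0) :
    segment ℝ a b ∩ segment ℝ b c = {b} := by
  apply Set.Subset.antisymm
  · rintro z ⟨h1, h2⟩
    obtain ⟨t, -, -, hx, hy⟩ := mem_segment_iff_coord.1 h1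
    obtain ⟨s, -, -, hx', hy'⟩ := mem_segment_iff_coord.1 h2
    have hs : s * ((b 0 - a 0) * (c 1 - a 1) - (b 1 - a 1) * (c 0 - a 0)) = 0 := by
      linear_combination (b 1 - a 1) * (hx' - hx) - (b 0 - a 0) * (hy' - hy)
    have hs0 : s = 0 := (mul_eq_zero.1 hs).resolve_right h
    subst hs0
    exact plane_ext (by simpa using hx') (by simpa using hy')
  · rintro z rfl
    exact ⟨right_mem_segment ℝ _ _, left_mem_segment ℝ _ _⟩

/-- The abscissae of the vertices. -/
noncomputable def vx : Fin 10 → ℝ := ![0, 3, 10, 14, 13, 11, 9, 7, 6, 4]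

/-- The ordinates of the vertices. -/
noncomputable def vy : Fin 10 → ℝ := ![-3, 0, 0, -4, 1, 0, 1, 4, 2, 4]

/-- The vertices. -/
noncomputable def vert (i : Fin 10) : Plane := pt (vx i) (vy i)

theorem forall_fin_ten {p : Fin 10 → Prop} (h0 : p 0) (h1 : p 1) (h2 : p 2) (h3 : p 3) (h4 : p 4)
    (h5 : p 5) (h6 : p 6) (h7 : p 7) (h8 : p 8) (h9 : p 9) (i : Fin 10) : p i := by
  fin_cases i <;> assumption

theorem vert_zero : vert 0 = pt 0 (-3) := rfl
theorem vert_one : vert 1 = pt 3 0 := rfl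
theorem vert_two : vert 2 = pt 10 0 := rfl
theorem vert_three : vert 3 = pt 14 (-4) := rfl
theorem vert_four : vert 4 = pt 13 1 := rfl
theorem vert_five : vert 5 = pt 11 0 := rfl
theorem vert_six : vert 6 = pt 9 1 := rfl
theorem vert_seven : vert 7 = pt 7 4 := rfl
theorem vert_eight : vert 8 = pt 6 2 := rfl
theorem vert_nine : vert 9 = pt 4 4 := rfl

theorem vert_det_ne_zero (i : Fin 10) :
    (vert (i + 1) 0 - vert i 0) * (vert (i + 1 + 1) 1 - vert i 1) -
      (vert (i + 1) 1 - vert i 1) * (vert (i + 1 + 1) 0 - vert i 0) ≠ 0 := by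
  revert i
  refine forall_fin_ten ?_ ?_ ?_ ?_ ?_ ?_ ?_ ?_ ?_ ?_
  · change (vert 1 0 - vert 0 0) * (vert 2 1 - vert 0 1) -
      (vert 1 1 - vert 0 1) * (vert 2 0 - vert 0 0) ≠ 0
    norm_num [vert_zero, vert_one, vert_two]
  · change (vert 2 0 - vert 1 0) * (vert 3 1 - vert 1 1) -
      (vert 2 1 - vert 1 1) * (vert 3 0 - vert 1 0) ≠ 0
    norm_num [vert_one, vert_two, vert_three]
  · change (vert 3 0 - vert 2 0) * (vert 4 1 - vert 2 1) -
      (vert 3 1 - vert 2 1) * (vert 4 0 - vert 2 0) ≠ 0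
    norm_num [vert_two, vert_three, vert_four]
  · change (vert 4 0 - vert 3 0) * (vert 5 1 - vert 3 1) -
      (vert 4 1 - vert 3 1) * (vert 5 0 - vert 3 0) ≠ 0
    norm_num [vert_three, vert_four, vert_five]
  · change (vert 5 0 - vert 4 0) * (vert 6 1 - vert 4 1) -
      (vert 5 1 - vert 4 1) * (vert 6 0 - vert 4 0) ≠ 0
    norm_num [vert_four, vert_five, vert_six]
  · change (vert 6 0 - vert 5 0) * (vert 7 1 - vert 5 1) -
      (vert 6 1 - vert 5 1) * (vert 7 0 - vert 5 0) ≠ 0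
    norm_num [vert_five, vert_six, vert_seven]
  · change (vert 7 0 - vert 6 0) * (vert 8 1 - vert 6 1) -
      (vert 7 1 - vert 6 1) * (vert 8 0 - vert 6 0) ≠ 0
    norm_num [vert_six, vert_seven, vert_eight]
  · change (vert 8 0 - vert 7 0) * (vert 9 1 - vert 7 1) -
      (vert 8 1 - vert 7 1) * (vert 9 0 - vert 7 0) ≠ 0
    norm_num [vert_seven, vert_eight, vert_nine]
  · change (vert 9 0 - vert 8 0) * (vert 0 1 - vert 8 1) -
      (vert 9 1 - vert 8 1) * (vert 0 0 - vert 8 0) ≠ 0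
    norm_num [vert_eight, vert_nine, vert_zero]
  · change (vert 0 0 - vert 9 0) * (vert 1 1 - vert 9 1) -
      (vert 0 1 - vert 9 1) * (vert 1 0 - vert 9 0) ≠ 0
    norm_num [vert_nine, vert_zero, vert_one]

/-- The edge between two consecutive vertices. -/
def side (i : Fin 10) : Set Plane := segment ℝ (vert i) (vert (i + 1))

theorem mem_side_zero {z : Plane} : z ∈ side 0 ↔ 0 ≤ z 0 ∧ z 0 ≤ 3 ∧ z 1 = z 0 - 3 := by
  change z ∈ segment ℝ (vert 0) (vert 1) ↔ _
  rw [vert_zero, vert_one, mem_segment_iff_line (by simp)]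
  simp only [pt_zero, pt_one]
  grind

theorem mem_side_one {z : Plane} : z ∈ side 1 ↔ 3 ≤ z 0 ∧ z 0 ≤ 10 ∧ z 1 = 0 := by
  change z ∈ segment ℝ (vert 1) (vert 2) ↔ _
  rw [vert_one, vert_two, mem_segment_iff_line (by norm_num)]
  simp only [pt_zero, pt_one]
  grind

theorem mem_side_two {z : Plane} : z ∈ side 2 ↔ 10 ≤ z 0 ∧ z 0 ≤ 14 ∧ z 1 = 10 - z 0 := by
  change z ∈ segment ℝ (vert 2) (vert 3) ↔ _
  rw [vert_two, vert_three, mem_segment_iff_line (by norm_num)]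
  simp only [pt_zero, pt_one]
  grind

theorem mem_side_three {z : Plane} : z ∈ side 3 ↔ 13 ≤ z 0 ∧ z 0 ≤ 14 ∧ z 1 = 66 - 5 * z 0 := by
  change z ∈ segment ℝ (vert 3) (vert 4) ↔ _
  rw [segment_symm, vert_three, vert_four, mem_segment_iff_line (by norm_num)]
  simp only [pt_zero, pt_one]
  grind

theorem mem_side_four {z : Plane} : z ∈ side 4 ↔ 11 ≤ z 0 ∧ z 0 ≤ 13 ∧ z 1 = (z 0 - 11) / 2 := by
  change z ∈ segment ℝ (vert 4) (vert 5) ↔ _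
  rw [segment_symm, vert_four, vert_five, mem_segment_iff_line (by norm_num)]
  simp only [pt_zero, pt_one]
  grind

theorem mem_side_five {z : Plane} : z ∈ side 5 ↔ 9 ≤ z 0 ∧ z 0 ≤ 11 ∧ z 1 = (11 - z 0) / 2 := by
  change z ∈ segment ℝ (vert 5) (vert 6) ↔ _
  rw [segment_symm, vert_five, vert_six, mem_segment_iff_line (by norm_num)]
  simp only [pt_zero, pt_one]
  grind

theorem mem_side_six {z : Plane} :
    z ∈ side 6 ↔ 7 ≤ z 0 ∧ z 0 ≤ 9 ∧ z 1 = (29 - 3 * z 0) / 2 := by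
  change z ∈ segment ℝ (vert 6) (vert 7) ↔ _
  rw [segment_symm, vert_six, vert_seven, mem_segment_iff_line (by norm_num)]
  simp only [pt_zero, pt_one]
  grind

theorem mem_side_seven {z : Plane} : z ∈ side 7 ↔ 6 ≤ z 0 ∧ z 0 ≤ 7 ∧ z 1 = 2 * z 0 - 10 := by
  change z ∈ segment ℝ (vert 7) (vert 8) ↔ _
  rw [segment_symm, vert_seven, vert_eight, mem_segment_iff_line (by norm_num)]
  simp only [pt_zero, pt_one]
  grind

theorem mem_side_eight {z : Plane} : z ∈ side 8 ↔ 4 ≤ z 0 ∧ z 0 ≤ 6 ∧ z 1 = 8 - z 0 := by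
  change z ∈ segment ℝ (vert 8) (vert 9) ↔ _
  rw [segment_symm, vert_eight, vert_nine, mem_segment_iff_line (by norm_num)]
  simp only [pt_zero, pt_one]
  grind

theorem mem_side_nine {z : Plane} :
    z ∈ side 9 ↔ 0 ≤ z 0 ∧ z 0 ≤ 4 ∧ z 1 = (7 * z 0 - 12) / 4 := by
  change z ∈ segment ℝ (vert 9) (vert 0) ↔ _
  rw [segment_symm, vert_nine, vert_zero, mem_segment_iff_line (by norm_num)]
  simp only [pt_zero, pt_one]
  grind

theorem side_disjoint_of_lt (i j : Fin 10) (hij : i < j) (h1 : j ≠ i + 1) (h2 : i ≠ j + 1) :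
    Disjoint (side i) (side j) := by
  rw [Set.disjoint_left]
  intro z
  revert i j
  refine forall_fin_ten ?_ ?_ ?_ ?_ ?_ ?_ ?_ ?_ ?_ ?_ <;>
  refine forall_fin_ten ?_ ?_ ?_ ?_ ?_ ?_ ?_ ?_ ?_ ?_ <;> intro h1 h2 h3 <;>
  first
  | exact absurd h1 (by decide)
  | exact absurd rfl h2
  | exact absurd rfl h3
  | (simp only [mem_side_zero, mem_side_one, mem_side_two, mem_side_three, mem_side_four,
      mem_side_five, mem_side_six, mem_side_seven, mem_side_eight, mem_side_nine]
     rintro ⟨_, _, _⟩ ⟨_, _, _⟩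
     linarith)

/-- A monotone polygon with two lobes and a spike between them. -/
noncomputable def lobedPolygon : SimplePolygon where
  n := 10
  three_le := by norm_num
  vertex := vert
  corner i h := by
    have e : (i : ZMod 10) + 2 = i + 1 + 1 := by ring
    rw [e] at h
    exact vert_det_ne_zero i (det_eq_zero_of_collinear h)
  consecutive_inter i := segment_inter_segment_of_det_ne_zero (vert_det_ne_zero i)
  nonconsecutive_disjoint i j h1 h2 h3 := by
    rcases lt_or_gt_of_ne (α := Fin 10) h1 with h | h
    · exact (side_disjoint_of_lt j i h h3 h2).symm
    · exact side_disjoint_of_lt i j h h2 h3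
  counterclockwise := by
    simp only [Finset.sum_range_succ, Finset.sum_range_zero]
    change 0 < 0 + (vert 0 0 * vert 1 1 - vert 1 0 * vert 0 1) +
      (vert 1 0 * vert 2 1 - vert 2 0 * vert 1 1) + (vert 2 0 * vert 3 1 - vert 3 0 * vert 2 1) +
      (vert 3 0 * vert 4 1 - vert 4 0 * vert 3 1) + (vert 4 0 * vert 5 1 - vert 5 0 * vert 4 1) +
      (vert 5 0 * vert 6 1 - vert 6 0 * vert 5 1) + (vert 6 0 * vert 7 1 - vert 7 0 * vert 6 1) +
      (vert 7 0 * vert 8 1 - vert 8 0 * vert 7 1) + (vert 8 0 * vert 9 1 - vert 9 0 * vert 8 1) +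
      (vert 9 0 * vert 0 1 - vert 0 0 * vert 9 1)
    simp only [vert_zero, vert_one, vert_two, vert_three, vert_four, vert_five, vert_six,
      vert_seven, vert_eight, vert_nine, pt_zero, pt_one]
    norm_num

/-- The lower boundary of the polygon as a function of the abscissa. -/
noncomputable def lower (x : ℝ) : ℝ := min (x - 3) (min 0 (10 - x))

/-- The upper boundary of the polygon as a function of the abscissa. -/
noncomputable def upper (x : ℝ) : ℝ :=
  min (min ((7 * x - 12) / 4) (66 - 5 * x))
    (max (8 - x) (max (min (2 * x - 10) (max ((29 - 3 * x) / 2) ((11 - x) / 2))) ((x - 11) / 2)))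

theorem continuous_lower : Continuous lower := by unfold lower; fun_prop

theorem continuous_upper : Continuous upper := by unfold upper; fun_prop

/-- The points strictly between the lower and the upper boundary. -/
def openStrip : Set Plane := {z | lower (z 0) < z 1 ∧ z 1 < upper (z 0)}

/-- The points between the lower and the upper boundary. -/
def closedStrip : Set Plane := {z | lower (z 0) ≤ z 1 ∧ z 1 ≤ upper (z 0)}

theorem lower_lt_iff {x y : ℝ} : lower x < y ↔ x - 3 < y ∨ 0 < y ∨ 10 - x < y := by
  simp [lower]

theorem lower_le_iff {x y : ℝ} : lower x ≤ y ↔ x - 3 ≤ y ∨ 0 ≤ y ∨ 10 - x ≤ y := by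
  simp only [lower, min_le_iff]

theorem lt_upper_iff {x y : ℝ} : y < upper x ↔ (y < (7 * x - 12) / 4 ∧ y < 66 - 5 * x) ∧
    (y < 8 - x ∨ (y < 2 * x - 10 ∧ (y < (29 - 3 * x) / 2 ∨ y < (11 - x) / 2)) ∨
      y < (x - 11) / 2) := by
  simp only [upper, lt_min_iff, lt_max_iff]

theorem le_upper_iff {x y : ℝ} : y ≤ upper x ↔ (y ≤ (7 * x - 12) / 4 ∧ y ≤ 66 - 5 * x) ∧
    (y ≤ 8 - x ∨ (y ≤ 2 * x - 10 ∧ (y ≤ (29 - 3 * x) / 2 ∨ y ≤ (11 - x) / 2)) ∨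
      y ≤ (x - 11) / 2) := by
  simp only [upper, le_min_iff, le_max_iff]

theorem isOpen_openStrip : IsOpen openStrip := by
  have h0 : Continuous fun z : Plane => z 0 := by fun_prop
  have h1 : Continuous fun z : Plane => z 1 := by fun_prop
  exact (isOpen_lt (continuous_lower.comp h0) h1).inter (isOpen_lt h1 (continuous_upper.comp h0))

theorem isClosed_closedStrip : IsClosed closedStrip := by
  have h0 : Continuous fun z : Plane => z 0 := by fun_prop
  have h1 : Continuous fun z : Plane => z 1 := by fun_prop
  exact (isClosed_le (continuous_lower.comp h0) h1).inter
    (isClosed_le h1 (continuous_upper.comp h0))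

theorem openStrip_subset_closedStrip : openStrip ⊆ closedStrip := fun _ h => ⟨h.1.le, h.2.le⟩

theorem mem_boundary_iff {z : Plane} : z ∈ lobedPolygon.boundary ↔ ∃ i : Fin 10, z ∈ side i :=
  Set.mem_iUnion

theorem side_subset_strip (i : Fin 10) : ∀ z ∈ side i, z ∈ closedStrip ∧ z ∉ openStrip := by
  revert i
  refine forall_fin_ten ?_ ?_ ?_ ?_ ?_ ?_ ?_ ?_ ?_ ?_ <;> intro z <;>
  simp only [mem_side_zero, mem_side_one, mem_side_two, mem_side_three, mem_side_four,
      mem_side_five, mem_side_six, mem_side_seven, mem_side_eight, mem_side_nine,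
      closedStrip, openStrip, Set.mem_ofPred_eq, lower_lt_iff, lower_le_iff, lt_upper_iff,
      le_upper_iff] <;>
  rintro ⟨h1, h2, h3⟩ <;> rw [h3] <;> grind

theorem eq_side_of_mem_strip {x y : ℝ} (h : lower x ≤ y ∧ y ≤ upper x)
    (h' : ¬(lower x < y ∧ y < upper x)) :
    ((0 ≤ x ∧ x ≤ 3 ∧ y = x - 3) ∨ (3 ≤ x ∧ x ≤ 10 ∧ y = 0) ∨ (10 ≤ x ∧ x ≤ 14 ∧ y = 10 - x)) ∨
    ((13 ≤ x ∧ x ≤ 14 ∧ y = 66 - 5 * x) ∨ (11 ≤ x ∧ x ≤ 13 ∧ y = (x - 11) / 2) ∨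
      (9 ≤ x ∧ x ≤ 11 ∧ y = (11 - x) / 2) ∨ (7 ≤ x ∧ x ≤ 9 ∧ y = (29 - 3 * x) / 2) ∨
      (6 ≤ x ∧ x ≤ 7 ∧ y = 2 * x - 10) ∨ (4 ≤ x ∧ x ≤ 6 ∧ y = 8 - x) ∨
      (0 ≤ x ∧ x ≤ 4 ∧ y = (7 * x - 12) / 4)) := by
  rw [lower_le_iff, le_upper_iff] at h
  rw [lower_lt_iff, lt_upper_iff] at h'
  obtain ⟨hl, ⟨ha, hb⟩, hu⟩ := h
  have h0 : 0 ≤ x := by rcases hl with h | h | h <;> linarith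
  have h14 : x ≤ 14 := by rcases hl with h | h | h <;> linarith
  by_cases hlow : x - 3 < y ∨ 0 < y ∨ 10 - x < y
  · right
    rcases lt_or_ge y ((7 * x - 12) / 4) with h1 | h1
    · rcases lt_or_ge y (66 - 5 * x) with h2 | h2
      · have h3 := fun h => h' ⟨hlow, ⟨h1, h2⟩, h⟩
        change ¬_ at h3
        simp only [not_or, not_and_or, not_lt] at h3
        obtain ⟨h4, h5, h6⟩ := h3
        right
        rcases hu with h | ⟨h, h7⟩ | h
        · iterate 4 right
          left
          refine ⟨by linarith, ?_, by linarith⟩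
          rcases h5 with h5 | h5 <;> linarith
        · rcases h5 with h5 | ⟨h5, h8⟩
          · iterate 3 right
            left
            refine ⟨by linarith, ?_, by linarith⟩
            rcases h7 with h7 | h7 <;> linarith
          · rcases h7 with h7 | h7
            · right; right; left
              exact ⟨by linarith, by linarith, by linarith⟩
            · right; left
              exact ⟨by linarith, by linarith, by linarith⟩
        · left
          refine ⟨?_, by linarith, by linarith⟩
          rcases h5 with h5 | h5 <;> linarith
      · left
        refine ⟨?_, h14, le_antisymm hb h2⟩
        rcases hu with h | ⟨h, h3 | h3⟩ | h <;> linarith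
    · iterate 6 right
      refine ⟨h0, ?_, le_antisymm ha h1⟩
      rcases hu with h | ⟨h, -⟩ | h <;> linarith
  · left
    simp only [not_or, not_lt] at hlow
    obtain ⟨h1, h2, h3⟩ := hlow
    rcases hl with h | h | h
    · left
      exact ⟨h0, by linarith, by linarith⟩
    · right; left
      exact ⟨by linarith, by linarith, by linarith⟩
    · right; right
      exact ⟨by linarith, by linarith, by linarith⟩

theorem boundary_eq : lobedPolygon.boundary = closedStrip \ openStrip := by
  apply Set.Subset.antisymm
  · intro z hz
    obtain ⟨i, hi⟩ := mem_boundary_iff.1 hz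
    exact side_subset_strip i z hi
  · rintro z ⟨h1, h2⟩
    rw [mem_boundary_iff]
    have h : (z ∈ side 0 ∨ z ∈ side 1 ∨ z ∈ side 2) ∨
        (z ∈ side 3 ∨ z ∈ side 4 ∨ z ∈ side 5 ∨ z ∈ side 6 ∨ z ∈ side 7 ∨ z ∈ side 8 ∨ z ∈ side 9) := by
      simp only [mem_side_zero, mem_side_one, mem_side_two, mem_side_three, mem_side_four,
        mem_side_five, mem_side_six, mem_side_seven, mem_side_eight, mem_side_nine]
      exact eq_side_of_mem_strip h1 h2
    rcases h with (h | h | h) | (h | h | h | h | h | h | h) <;> exact ⟨_, h⟩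

theorem isBounded_openStrip : Bornology.IsBounded openStrip := by
  refine (isBounded_iff_forall_norm_le).2 ⟨100, ?_⟩
  intro z hz
  have h : (0 ≤ z 0 ∧ z 0 ≤ 14) ∧ -4 ≤ z 1 ∧ z 1 ≤ 22 := by
    obtain ⟨h1, h2⟩ := hz
    rw [lower_lt_iff] at h1
    obtain ⟨⟨ha, hb⟩, -⟩ := lt_upper_iff.1 h2
    have h0 : 0 ≤ z 0 := by rcases h1 with h | h | h <;> linarith
    have h14 : z 0 ≤ 14 := by rcases h1 with h | h | h <;> linarith
    refine ⟨⟨h0, h14⟩, ?_, by linarith⟩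
    rcases h1 with h | h | h <;> linarith
  obtain ⟨⟨h1, h2⟩, h3, h4⟩ := h
  rw [EuclideanSpace.norm_eq, Real.sqrt_le_left (by norm_num)]
  simp only [Fin.sum_univ_two, Real.norm_eq_abs, sq_abs]
  nlinarith

theorem not_isBounded_of_forall_norm {s : Set Plane} (h : ∀ r : ℝ, ∃ z ∈ s, r < ‖z‖) :
    ¬ Bornology.IsBounded s := by
  intro hb
  obtain ⟨C, hC⟩ := isBounded_iff_forall_norm_le.1 hb
  obtain ⟨z, hz, hr⟩ := h C
  exact absurd (hC z hz) (not_le.2 hr)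

/-- A set containing a vertical ray is unbounded. -/
theorem not_isBounded_of_ray_subset {s : Set Plane} {a b e : ℝ} (he : |e| = 1)
    (h : (fun t : ℝ => pt a (b + e * t)) '' Set.Ici 0 ⊆ s) : ¬ Bornology.IsBounded s := by
  refine not_isBounded_of_forall_norm fun r => ?_
  refine ⟨pt a (b + e * (|r| + |b| + 1)), h ⟨|r| + |b| + 1, ?_, rfl⟩, ?_⟩
  · simp only [Set.mem_Ici]; positivity
  · have h1 : ‖(pt a (b + e * (|r| + |b| + 1))) 1‖ ≤ ‖pt a (b + e * (|r| + |b| + 1))‖ :=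
      PiLp.norm_apply_le _ 1
    refine lt_of_lt_of_le ?_ h1
    rw [pt_one, Real.norm_eq_abs]
    have h2 : |e * (|r| + |b| + 1)| = |r| + |b| + 1 := by
      rw [abs_mul, he, one_mul, abs_of_pos (by positivity)]
    have h3 := abs_sub_abs_le_abs_sub (e * (|r| + |b| + 1)) (-b)
    rw [h2, abs_neg, sub_neg_eq_add, add_comm (e * _) b] at h3
    linarith [le_abs_self r]

theorem not_isBounded_component {a b e : ℝ} (he : |e| = 1)
    (h : ∀ t : ℝ, 0 ≤ t → pt a (b + e * t) ∉ closedStrip) :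
    ¬ Bornology.IsBounded (connectedComponentIn lobedPolygon.boundaryᶜ (pt a b)) := by
  refine not_isBounded_of_ray_subset (a := a) (b := b) he ?_
  have hc : Continuous fun t : ℝ => pt a (b + e * t) := by
    unfold pt
    fun_prop
  refine IsPreconnected.subset_connectedComponentIn
    (isPreconnected_Ici.image _ hc.continuousOn) ⟨0, by simp, by simp⟩ ?_
  rintro _ ⟨t, ht, rfl⟩ hb
  rw [boundary_eq] at hb
  exact h t ht hb.1

theorem int_eq : lobedPolygon.int = openStrip := by
  have hcompl : lobedPolygon.boundaryᶜ = openStrip ∪ closedStripᶜ := by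
    rw [boundary_eq]
    ext z
    simp only [Set.mem_compl_iff, Set.mem_sdiff, Set.mem_union]
    tauto
  apply Set.Subset.antisymm
  · rintro z ⟨hz, hb⟩
    rw [hcompl] at hz
    refine hz.resolve_right fun hout => ?_
    have hzp : z = pt (z 0) (z 1) := plane_ext (by simp) (by simp)
    have h : z 1 < lower (z 0) ∨ upper (z 0) < z 1 := by
      by_contra hc
      simp only [not_or, not_lt] at hc
      exact hout hc
    rw [hzp] at hb
    rcases h with h | h
    · refine not_isBounded_component (e := -1) (by simp) (fun t ht hm => ?_) hb
      have := hm.1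
      simp only [pt_zero, pt_one] at this
      linarith
    · refine not_isBounded_component (e := 1) (by simp) (fun t ht hm => ?_) hb
      have := hm.2
      simp only [pt_zero, pt_one] at this
      linarith
  · intro z hz
    have hzc : z ∈ lobedPolygon.boundaryᶜ := by rw [hcompl]; exact Or.inl hz
    refine ⟨hzc, isBounded_openStrip.subset ?_⟩
    refine isPreconnected_connectedComponentIn.subset_left_of_subset_union isOpen_openStrip
      isClosed_closedStrip.isOpen_compl ?_ ?_ ⟨z, mem_connectedComponentIn hzc, hz⟩
    · exact Set.disjoint_compl_right_iff_subset.2 openStrip_subset_closedStrip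
    · rw [← hcompl]
      exact connectedComponentIn_subset _ _

theorem region_eq : lobedPolygon.region = closedStrip := by
  rw [SimplePolygon.region, int_eq, boundary_eq,
    Set.union_sdiff_cancel openStrip_subset_closedStrip]

theorem isMonotone_lobedPolygon : lobedPolygon.IsMonotone := by
  refine ⟨LinearIsometryEquiv.refl ℝ Plane, ?_, fun c => ?_⟩
  · exact LinearMap.det_id
  · have : (LinearIsometryEquiv.refl ℝ Plane '' lobedPolygon.region) ∩ {x | x 0 = c} =
        (fun t : ℝ => pt c t) '' Set.Icc (lower c) (upper c) := by
      rw [region_eq, LinearIsometryEquiv.coe_refl, Set.image_id]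
      apply Set.Subset.antisymm
      · rintro z ⟨⟨h1, h2⟩, rfl⟩
        exact ⟨z 1, ⟨h1, h2⟩, plane_ext (by simp) (by simp)⟩
      · rintro _ ⟨t, ⟨h1, h2⟩, rfl⟩
        exact ⟨⟨by simpa using h1, by simpa using h2⟩, pt_zero _ _⟩
    rw [this]
    have hc : Continuous fun t : ℝ => pt c t := by
      unfold pt
      fun_prop
    exact isPreconnected_Icc.image _ hc.continuousOn

theorem visible_self (p : Plane) : lobedPolygon.Visible p p := by
  rintro z ⟨hz, hn⟩
  rw [segment_same] at hz
  exact absurd (Or.inl hz) hn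

theorem visible_symm {p q : Plane} (h : lobedPolygon.Visible p q) : lobedPolygon.Visible q p := by
  unfold SimplePolygon.Visible at *
  rwa [segment_symm, Set.pair_comm]

theorem visible_of_forall {a b c d : ℝ}
    (h : ∀ t x y : ℝ, 0 < t → t < 1 → x = a + t * (c - a) → y = b + t * (d - b) →
      (x - 3 < y ∨ 0 < y ∨ 10 - x < y) ∧ (y < (7 * x - 12) / 4 ∧ y < 66 - 5 * x) ∧
        (y < 8 - x ∨ (y < 2 * x - 10 ∧ (y < (29 - 3 * x) / 2 ∨ y < (11 - x) / 2)) ∨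
          y < (x - 11) / 2)) :
    lobedPolygon.Visible (pt a b) (pt c d) := by
  rintro z ⟨hz, hn⟩
  rw [int_eq]
  obtain ⟨t, h0, h1, hx, hy⟩ := mem_segment_iff_coord.1 hz
  simp only [pt_zero, pt_one] at hx hy
  have ht0 : t ≠ 0 := by
    rintro rfl
    exact hn (Or.inl (plane_ext (by simpa using hx) (by simpa using hy)))
  have ht1 : t ≠ 1 := by
    rintro rfl
    exact hn (Or.inr (plane_ext (by simpa using hx) (by simpa using hy)))
  have := h t _ _ (lt_of_le_of_ne h0 ht0.symm) (lt_of_le_of_ne h1 ht1) hx hy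
  exact ⟨lower_lt_iff.2 this.1, lt_upper_iff.2 this.2⟩

/-- A line of sight stays strictly between the lower and the upper boundary. -/
theorem strip_of_visible {w p : Plane} (h : lobedPolygon.Visible w p) {c : ℝ}
    (hc : (w 0 < c ∧ c < p 0) ∨ (p 0 < c ∧ c < w 0)) :
    lower c < w 1 + (p 1 - w 1) / (p 0 - w 0) * (c - w 0) ∧
      w 1 + (p 1 - w 1) / (p 0 - w 0) * (c - w 0) < upper c := by
  have hd : p 0 - w 0 ≠ 0 := by
    intro h0
    rcases hc with ⟨h1, h2⟩ | ⟨h1, h2⟩ <;> linarith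
  have ht : 0 ≤ (c - w 0) / (p 0 - w 0) ∧ (c - w 0) / (p 0 - w 0) ≤ 1 := by
    rcases hc with ⟨h1, h2⟩ | ⟨h1, h2⟩
    · exact ⟨div_nonneg (by linarith) (by linarith), (div_le_one (by linarith)).2 (by linarith)⟩
    · exact ⟨div_nonneg_of_nonpos (by linarith) (by linarith),
        (div_le_one_of_neg (by linarith)).2 (by linarith)⟩
  have hz : pt c (w 1 + (p 1 - w 1) / (p 0 - w 0) * (c - w 0)) ∈ lobedPolygon.int := by
    refine h ⟨mem_segment_iff_coord.2 ⟨(c - w 0) / (p 0 - w 0), ht.1, ht.2, ?_, ?_⟩, ?_⟩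
    · rw [pt_zero]; field_simp; ring
    · rw [pt_one]; field_simp
    · rintro (he | he)
      · have := congrArg (fun z : Plane => z 0) he
        simp only [pt_zero] at this
        rcases hc with ⟨h1, h2⟩ | ⟨h1, h2⟩ <;> linarith
      · have := congrArg (fun z : Plane => z 0) (Set.mem_singleton_iff.1 he)
        simp only [pt_zero] at this
        rcases hc with ⟨h1, h2⟩ | ⟨h1, h2⟩ <;> linarith
  rw [int_eq] at hz
  have := hz
  simp only [openStrip, Set.mem_ofPred_eq, pt_zero, pt_one] at this
  exact this

theorem not_visible_of_blocked {a b a' b' : ℝ} (c : ℝ) (hc : (a < c ∧ c < a') ∨ (a' < c ∧ c < a))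
    (h : b + (b' - b) / (a' - a) * (c - a) ≤ lower c ∨
      upper c ≤ b + (b' - b) / (a' - a) * (c - a)) :
    ¬ lobedPolygon.Visible (pt a b) (pt a' b') := by
  intro hv
  have := strip_of_visible hv (c := c) (by simpa using hc)
  simp only [pt_zero, pt_one] at this
  rcases h with h | h <;> linarith [this.1, this.2]

/-- Pairs of vertices whose connecting segment leaves the interior. -/
def blockedPairs : List (Fin 10 × Fin 10) :=
  [(0, 2), (0, 3), (0, 4), (0, 5), (0, 6), (0, 7), (2, 9), (3, 9),
    (4, 9), (5, 9), (6, 9), (7, 9), (1, 3), (1, 4), (1, 5), (1, 7),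
    (3, 6), (3, 7), (3, 8), (4, 6), (4, 7), (4, 8), (2, 7), (5, 7)]

theorem not_visible_of_mem_blockedPairs :
    ∀ e ∈ blockedPairs, ¬ lobedPolygon.Visible (vert e.1) (vert e.2) := by
  simp only [blockedPairs, List.forall_mem_cons, vert_zero, vert_one, vert_two, vert_three,
    vert_four, vert_five, vert_six, vert_seven, vert_eight, vert_nine]
  refine ⟨not_visible_of_blocked 3 ?_ ?_, not_visible_of_blocked 3 ?_ ?_, not_visible_of_blocked 3 ?_ ?_,
    not_visible_of_blocked 3 ?_ ?_, not_visible_of_blocked 3 ?_ ?_, not_visible_of_blocked 3 ?_ ?_,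
    not_visible_of_blocked 6 ?_ ?_, not_visible_of_blocked 6 ?_ ?_, not_visible_of_blocked 6 ?_ ?_,
    not_visible_of_blocked 6 ?_ ?_, not_visible_of_blocked 6 ?_ ?_, not_visible_of_blocked 6 ?_ ?_,
    not_visible_of_blocked 10 ?_ ?_, not_visible_of_blocked 11 ?_ ?_, not_visible_of_blocked 5 ?_ ?_,
    not_visible_of_blocked 6 ?_ ?_, not_visible_of_blocked 10 ?_ ?_, not_visible_of_blocked 9 ?_ ?_,
    not_visible_of_blocked 10 ?_ ?_, not_visible_of_blocked 11 ?_ ?_, not_visible_of_blocked 11 ?_ ?_,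
    not_visible_of_blocked 11 ?_ ?_, not_visible_of_blocked 9 ?_ ?_, not_visible_of_blocked 9 ?_ ?_, by simp⟩
  all_goals norm_num [lower, upper, le_min_iff, min_le_iff, max_le_iff]

theorem exists_pair_of_isClosedMobileGuard {g : Set Plane}
    (hg : lobedPolygon.IsClosedMobileGuard g) :
    ∃ i j : Fin 10, i < j ∧ (i, j) ∉ blockedPairs ∧ g = segment ℝ (vert i) (vert j) := by
  rcases hg with ⟨i, rfl⟩ | ⟨i, j, hij, -, -, rfl, hv⟩
  · change Fin 10 at i
    have key : ∀ i : Fin 10, (i < i + 1 ∧ (i, i + 1) ∉ blockedPairs) ∨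
        (i + 1 < i ∧ (i + 1, i) ∉ blockedPairs) := by decide
    rcases key i with ⟨h1, h2⟩ | ⟨h1, h2⟩
    · exact ⟨i, i + 1, h1, h2, rfl⟩
    · exact ⟨i + 1, i, h1, h2, segment_symm ℝ _ _⟩
  · rcases lt_or_gt_of_ne (α := Fin 10) hij with h | h
    · refine ⟨j, i, h, fun hb => ?_, segment_symm ℝ _ _⟩
      exact not_visible_of_mem_blockedPairs _ hb (visible_symm hv)
    · exact ⟨i, j, h, fun hb => not_visible_of_mem_blockedPairs _ hb hv, rfl⟩

theorem le_of_mem_segment {p q z : Plane} {c : ℝ} (hz : z ∈ segment ℝ p q) (hp : c ≤ p 0)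
    (hq : c ≤ q 0) : c ≤ z 0 := by
  obtain ⟨t, h0, h1, hx, -⟩ := mem_segment_iff_coord.1 hz
  rw [hx]
  nlinarith

theorem ge_of_mem_segment {p q z : Plane} {c : ℝ} (hz : z ∈ segment ℝ p q) (hp : p 0 ≤ c)
    (hq : q 0 ≤ c) : z 0 ≤ c := by
  obtain ⟨t, h0, h1, hx, -⟩ := mem_segment_iff_coord.1 hz
  rw [hx]
  nlinarith

/-- A location near the tip of the left lobe. -/
noncomputable def leftLoc : Plane := pt 1 (-9 / 5)

/-- A location in the right lobe. -/
noncomputable def rightLoc : Plane := pt 12 (1 / 4)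

/-- A location in the spike. -/
noncomputable def spikeLoc : Plane := pt 7 (7 / 2)

theorem leftLoc_mem : leftLoc ∈ lobedPolygon.int := by
  rw [int_eq]
  refine ⟨lower_lt_iff.2 ?_, lt_upper_iff.2 ?_⟩ <;> norm_num [leftLoc]

theorem rightLoc_mem : rightLoc ∈ lobedPolygon.int := by
  rw [int_eq]
  refine ⟨lower_lt_iff.2 ?_, lt_upper_iff.2 ?_⟩ <;> norm_num [rightLoc]

theorem spikeLoc_mem : spikeLoc ∈ lobedPolygon.int := by
  rw [int_eq]
  refine ⟨lower_lt_iff.2 ?_, lt_upper_iff.2 ?_⟩ <;> norm_num [spikeLoc]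

theorem lt_of_visible_leftLoc {p : Plane} (h : lobedPolygon.Visible leftLoc p) : p 0 < 6 := by
  by_contra! hp
  have h1 := (strip_of_visible h (c := 3) (Or.inl (by norm_num [leftLoc]; linarith))).1
  have h2 := (strip_of_visible h (c := 59 / 10)
    (Or.inl (by norm_num [leftLoc]; linarith))).2
  rw [lower_lt_iff] at h1
  rw [lt_upper_iff] at h2
  simp only [leftLoc, pt_zero, pt_one] at h1 h2
  generalize (p 1 - -9 / 5) / (p 0 - 1) = m at h1 h2
  rcases h1 with h1 | h1 | h1 <;> rcases h2.2 with h2 | ⟨h2, -⟩ | h2 <;> linarith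

theorem gt_of_visible_rightLoc {p : Plane} (h : lobedPolygon.Visible rightLoc p) : 10 < p 0 := by
  by_contra! hp
  have h1 := (strip_of_visible h (c := 101 / 10)
    (Or.inr (by norm_num [rightLoc]; linarith))).1
  have h2 := (strip_of_visible h (c := 11) (Or.inr (by norm_num [rightLoc]; linarith))).2
  rw [lower_lt_iff] at h1
  rw [lt_upper_iff] at h2
  simp only [rightLoc, pt_zero, pt_one] at h1 h2
  generalize (p 1 - 1 / 4) / (p 0 - 12) = m at h1 h2
  rcases h1 with h1 | h1 | h1 <;> rcases h2.2 with h2 | ⟨-, h2 | h2⟩ | h2 <;> linarith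

theorem gt_of_visible_spikeLoc {p : Plane} (h : lobedPolygon.Visible spikeLoc p) : 4 < p 0 := by
  by_contra! hp
  have h1 := (strip_of_visible h (c := 9 / 2) (Or.inr (by norm_num [spikeLoc]; linarith))).1
  have h2 := (strip_of_visible h (c := 6) (Or.inr (by norm_num [spikeLoc]; linarith))).2
  rw [lower_lt_iff] at h1
  rw [lt_upper_iff] at h2
  simp only [spikeLoc, pt_zero, pt_one] at h1 h2
  generalize (p 1 - 7 / 2) / (p 0 - 7) = m at h1 h2
  rcases h1 with h1 | h1 | h1 <;> rcases h2.2 with h2 | ⟨h2, -⟩ | h2 <;> linarith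

theorem lt_of_visible_spikeLoc {p : Plane} (h : lobedPolygon.Visible spikeLoc p) : p 0 < 10 := by
  by_contra! hp
  have h1 := (strip_of_visible h (c := 99 / 10) (Or.inl (by norm_num [spikeLoc]; linarith))).1
  have h2 := (strip_of_visible h (c := 9) (Or.inl (by norm_num [spikeLoc]; linarith))).2
  rw [lower_lt_iff] at h1
  rw [lt_upper_iff] at h2
  simp only [spikeLoc, pt_zero, pt_one] at h1 h2
  generalize (p 1 - 7 / 2) / (p 0 - 7) = m at h1 h2
  rcases h1 with h1 | h1 | h1 <;> rcases h2.2 with h2 | ⟨-, h2 | h2⟩ | h2 <;> linarith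

/-- The left guards other than the lowest edge meet this set. -/
def leftPoints : Set Plane := 
  {pt (17 / 5) (59 / 20), pt (37 / 10) (14 / 5), pt 6 2, pt 10 0, pt (33 / 4) (7 / 8)}

/-- The right guards meet this set. -/
def rightPoints : Set Plane := {pt 10 0, pt 11 0, pt (27 / 2) (-3 / 2)}

set_option maxHeartbeats 1000000 in
theorem visible_leftPoints_rightPoints {p q : Plane} (hp : p ∈ leftPoints) (hq : q ∈ rightPoints) :
    lobedPolygon.Visible p q := by
  rcases hp with rfl | rfl | rfl | rfl | rfl <;> rcases hq with rfl | rfl | rfl <;>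
  first
  | exact visible_self _
  | (refine visible_of_forall fun t x y h0 h1 hx hy => ⟨?_, ⟨?_, ?_⟩, ?_⟩
     · by_contra hc
       simp only [not_or, not_lt] at hc
       obtain ⟨h2, h3, h4⟩ := hc
       linarith
     · linarith
     · linarith
     · by_contra hc
       simp only [not_or, not_and_or, not_lt] at hc
       obtain ⟨h2, h3 | ⟨h3, h4⟩, h5⟩ := hc <;> linarith)

theorem visible_six_one : lobedPolygon.Visible (vert 6) (vert 1) := by
  rw [vert_six, vert_one]
  refine visible_of_forall fun t x y h0 h1 hx hy => ⟨?_, ⟨?_, ?_⟩, ?_⟩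
  · by_contra hc
    simp only [not_or, not_lt] at hc
    obtain ⟨h2, h3, h4⟩ := hc
    linarith
  · linarith
  · linarith
  · by_contra hc
    simp only [not_or, not_and_or, not_lt] at hc
    obtain ⟨h2, h3 | ⟨h3, h4⟩, h5⟩ := hc <;> linarith

theorem visible_eight_one : lobedPolygon.Visible (vert 8) (vert 1) := by
  rw [vert_eight, vert_one]
  refine visible_of_forall fun t x y h0 h1 hx hy => ⟨?_, ⟨?_, ?_⟩, ?_⟩
  · by_contra hc
    simp only [not_or, not_lt] at hc
    obtain ⟨h2, h3, h4⟩ := hc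
    linarith
  · linarith
  · linarith
  · by_contra hc
    simp only [not_or, not_and_or, not_lt] at hc
    obtain ⟨h2, h3 | ⟨h3, h4⟩, h5⟩ := hc <;> linarith

theorem six_le_vert (i : Fin 10) (h : i ≠ 0 ∧ i ≠ 1 ∧ i ≠ 9) : 6 ≤ vert i 0 := by
  revert i
  refine forall_fin_ten ?_ ?_ ?_ ?_ ?_ ?_ ?_ ?_ ?_ ?_ <;>
  simp [vert_two, vert_three, vert_four, vert_five, vert_six, vert_seven, vert_eight] <;> norm_num

theorem vert_le_ten (i : Fin 10) (h : i ≠ 3 ∧ i ≠ 4 ∧ i ≠ 5) : vert i 0 ≤ 10 := by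
  revert i
  refine forall_fin_ten ?_ ?_ ?_ ?_ ?_ ?_ ?_ ?_ ?_ ?_ <;>
  simp [vert_zero, vert_one, vert_two, vert_six, vert_seven, vert_eight, vert_nine] <;> norm_num

theorem vert_le_four {i : Fin 10} (h : i = 0 ∨ i = 1 ∨ i = 9) : vert i 0 ≤ 4 := by
  rcases h with rfl | rfl | rfl <;> norm_num [vert_zero, vert_one, vert_nine]

theorem ten_le_vert {i : Fin 10} (h : i = 2 ∨ i = 3 ∨ i = 4 ∨ i = 5) : 10 ≤ vert i 0 := by
  rcases h with rfl | rfl | rfl | rfl <;>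
  norm_num [vert_two, vert_three, vert_four, vert_five]

theorem left_guard_cases {g : Set Plane} (hg : lobedPolygon.IsClosedMobileGuard g)
    (hs : lobedPolygon.GuardSees g leftLoc) :
    g = segment ℝ (vert 0) (vert 1) ∨ ∃ p ∈ leftPoints, p ∈ g := by
  obtain ⟨i, j, hij, hb, rfl⟩ := exists_pair_of_isClosedMobileGuard hg
  obtain ⟨p, hp, hv⟩ := hs
  have hend : (i = 0 ∨ i = 1 ∨ i = 9) ∨ (j = 0 ∨ j = 1 ∨ j = 9) := by
    by_contra hc
    simp only [not_or] at hc
    exact absurd (le_of_mem_segment hp (six_le_vert _ hc.1) (six_le_vert _ hc.2))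
      (not_le.2 (lt_of_visible_leftLoc hv))
  have key : ∀ i j : Fin 10, i < j → (i, j) ∉ blockedPairs →
      ((i = 0 ∨ i = 1 ∨ i = 9) ∨ (j = 0 ∨ j = 1 ∨ j = 9)) →
      (i = 0 ∧ j = 1) ∨ (i = 0 ∧ j = 9) ∨ (i = 1 ∧ j = 9) ∨ (i = 1 ∧ j = 6) ∨
        (i = 8 ∨ i = 2) ∨ (j = 8 ∨ j = 2) := by decide
  have h8 : vert 8 ∈ leftPoints := by simp [leftPoints, vert_eight]
  have h2 : vert 2 ∈ leftPoints := by simp [leftPoints, vert_two]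
  rcases key i j hij hb hend with ⟨rfl, rfl⟩ | ⟨rfl, rfl⟩ | ⟨rfl, rfl⟩ | ⟨rfl, rfl⟩ | h | h
  · exact Or.inl rfl
  · refine Or.inr ⟨pt (17 / 5) (59 / 20), by simp [leftPoints], ?_⟩
    rw [vert_zero, vert_nine, mem_segment_iff_coord]
    exact ⟨17 / 20, by norm_num⟩
  · refine Or.inr ⟨pt (37 / 10) (14 / 5), by simp [leftPoints], ?_⟩
    rw [vert_one, vert_nine, mem_segment_iff_coord]
    exact ⟨7 / 10, by norm_num⟩
  · refine Or.inr ⟨pt (33 / 4) (7 / 8), by simp [leftPoints], ?_⟩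
    rw [vert_one, vert_six, mem_segment_iff_coord]
    exact ⟨7 / 8, by norm_num⟩
  · refine Or.inr ⟨vert i, ?_, left_mem_segment ℝ _ _⟩
    rcases h with rfl | rfl <;> assumption
  · refine Or.inr ⟨vert j, ?_, right_mem_segment ℝ _ _⟩
    rcases h with rfl | rfl <;> assumption

set_option synthInstance.maxSize 1024 in
theorem right_guard_meets {g : Set Plane} (hg : lobedPolygon.IsClosedMobileGuard g)
    (hs : lobedPolygon.GuardSees g rightLoc) : ∃ q ∈ rightPoints, q ∈ g := by
  obtain ⟨i, j, hij, hb, rfl⟩ := exists_pair_of_isClosedMobileGuard hg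
  obtain ⟨p, hp, hv⟩ := hs
  have hend : (i = 3 ∨ i = 4 ∨ i = 5) ∨ (j = 3 ∨ j = 4 ∨ j = 5) := by
    by_contra hc
    simp only [not_or] at hc
    exact absurd (ge_of_mem_segment hp (vert_le_ten _ hc.1) (vert_le_ten _ hc.2))
      (not_le.2 (gt_of_visible_rightLoc hv))
  have key : ∀ i j : Fin 10, i < j → (i, j) ∉ blockedPairs →
      ((i = 3 ∨ i = 4 ∨ i = 5) ∨ (j = 3 ∨ j = 4 ∨ j = 5)) →
      (i = 3 ∧ j = 4) ∨ (i = 2 ∨ i = 5) ∨ (j = 2 ∨ j = 5) := by decide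
  have h5 : vert 5 ∈ rightPoints := by simp [rightPoints, vert_five]
  have h2 : vert 2 ∈ rightPoints := by simp [rightPoints, vert_two]
  rcases key i j hij hb hend with ⟨rfl, rfl⟩ | h | h
  · refine ⟨pt (27 / 2) (-3 / 2), by simp [rightPoints], ?_⟩
    rw [vert_three, vert_four, mem_segment_iff_coord]
    exact ⟨1 / 2, by norm_num⟩
  · refine ⟨vert i, ?_, left_mem_segment ℝ _ _⟩
    rcases h with rfl | rfl <;> assumption
  · refine ⟨vert j, ?_, right_mem_segment ℝ _ _⟩
    rcases h with rfl | rfl <;> assumption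

theorem spike_guard_sees {g : Set Plane} (hg : lobedPolygon.IsClosedMobileGuard g)
    (hs : lobedPolygon.GuardSees g spikeLoc) :
    g ≠ segment ℝ (vert 0) (vert 1) ∧
      lobedPolygon.GuardsSeeEachOther g (segment ℝ (vert 0) (vert 1)) := by
  constructor
  · rintro rfl
    obtain ⟨p, hp, hv⟩ := hs
    exact absurd (ge_of_mem_segment hp (vert_le_four (by simp)) (vert_le_four (by simp)))
      (not_le.2 (gt_of_visible_spikeLoc hv))
  obtain ⟨i, j, hij, hb, rfl⟩ := exists_pair_of_isClosedMobileGuard hg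
  obtain ⟨p, hp, hv⟩ := hs
  have key : ∀ i j : Fin 10, i < j → (i, j) ∉ blockedPairs →
      ((i = 0 ∨ i = 1 ∨ i = 9) ∧ (j = 0 ∨ j = 1 ∨ j = 9)) ∨
        ((i = 2 ∨ i = 3 ∨ i = 4 ∨ i = 5) ∧ (j = 2 ∨ j = 3 ∨ j = 4 ∨ j = 5)) ∨
        (i = 1 ∨ i = 6 ∨ i = 8) ∨ (j = 1 ∨ j = 6 ∨ j = 8) := by decide
  have hvis : ∀ k : Fin 10, (k = 1 ∨ k = 6 ∨ k = 8) → lobedPolygon.Visible (vert k) (vert 1) := by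
    rintro k (rfl | rfl | rfl)
    exacts [visible_self _, visible_six_one, visible_eight_one]
  rcases key i j hij hb with ⟨h1, h2⟩ | ⟨h1, h2⟩ | h | h
  · exact absurd (ge_of_mem_segment hp (vert_le_four h1) (vert_le_four h2))
      (not_le.2 (gt_of_visible_spikeLoc hv))
  · exact absurd (le_of_mem_segment hp (ten_le_vert h1) (ten_le_vert h2))
      (not_le.2 (lt_of_visible_spikeLoc hv))
  · exact ⟨vert i, left_mem_segment ℝ _ _, vert 1, right_mem_segment ℝ _ _, hvis i h⟩
  · exact ⟨vert j, right_mem_segment ℝ _ _, vert 1, right_mem_segment ℝ _ _, hvis j h⟩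

/-- No guard sees both the left and the right location. -/
theorem not_guardSees_leftLoc_and_rightLoc {g : Set Plane} (hg : lobedPolygon.IsClosedMobileGuard g)
    (hl : lobedPolygon.GuardSees g leftLoc) (hr : lobedPolygon.GuardSees g rightLoc) : False := by
  obtain ⟨i, j, hij, hb, rfl⟩ := exists_pair_of_isClosedMobileGuard hg
  obtain ⟨p, hp, hpv⟩ := hl
  obtain ⟨q, hq, hqv⟩ := hr
  have h1 : (i = 0 ∨ i = 1 ∨ i = 9) ∨ (j = 0 ∨ j = 1 ∨ j = 9) := by
    by_contra hc
    simp only [not_or] at hc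
    exact absurd (le_of_mem_segment hp (six_le_vert _ hc.1) (six_le_vert _ hc.2))
      (not_le.2 (lt_of_visible_leftLoc hpv))
  have h2 : (i = 3 ∨ i = 4 ∨ i = 5) ∨ (j = 3 ∨ j = 4 ∨ j = 5) := by
    by_contra hc
    simp only [not_or] at hc
    exact absurd (ge_of_mem_segment hq (vert_le_ten _ hc.1) (vert_le_ten _ hc.2))
      (not_le.2 (gt_of_visible_rightLoc hqv))
  have key : ∀ i j : Fin 10, i < j → (i, j) ∉ blockedPairs →
      ((i = 0 ∨ i = 1 ∨ i = 9) ∨ (j = 0 ∨ j = 1 ∨ j = 9)) →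
      ((i = 3 ∨ i = 4 ∨ i = 5) ∨ (j = 3 ∨ j = 4 ∨ j = 5)) → False := by decide
  exact key i j hij hb h1 h2

end HiddenGuards

theorem mainTheorem10 :
    ∃ P : HiddenGuards.SimplePolygon,
      P.IsMonotone ∧ ¬ P.AdmitsHiddenClosedMobileGuardSet := by
  open HiddenGuards in
  refine ⟨lobedPolygon, isMonotone_lobedPolygon, ?_⟩
  rintro ⟨S, ⟨hS, hcover⟩, hhid⟩
  obtain ⟨a, ha, hal⟩ := hcover _ leftLoc_mem
  obtain ⟨b, hb, hbr⟩ := hcover _ rightLoc_mem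
  obtain ⟨c, hc, hcs⟩ := hcover _ spikeLoc_mem
  have hab : a ≠ b := by
    rintro rfl
    exact not_guardSees_leftLoc_and_rightLoc (hS _ ha) hal hbr
  obtain ⟨q, hq, hqb⟩ := right_guard_meets (hS _ hb) hbr
  rcases left_guard_cases (hS _ ha) hal with rfl | ⟨p, hp, hpa⟩
  · obtain ⟨hne, hsee⟩ := spike_guard_sees (hS _ hc) hcs
    exact hhid _ hc _ ha hne hsee
  · exact hhid _ ha _ hb hab ⟨p, hpa, q, hqb, visible_leftPoints_rightPoints hp hq⟩
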